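/- Let $n \ge 0$ be even, let $k \ge 3$ be an integer, and let $\pi = (d_1, \ldots, d_n)$ be a list of integers such that both $\pi$ and $\pi - k = (d_1 - k, \ldots, d_n - k)$ are graphic, i.e. each of them is the degree sequence of a simple graph on $n$ vertices. Then there is a simple graph $G$ with degree sequence $\pi$ that contains $\lfloor k/2 \rfloor + 2$ pairwise edge-disjoint $1$-factors (perfect matchings). -/

import Mathlib

open Classical in
/-- The graph `G` on the vertices `0, …, n - 1` realizes the integer list `π`: the `v`-th entry of
`π` is the degree of the vertex `v`. -/
def SimpleGraph.Realizes {n : ℕ} (G : SimpleGraph (Fin n)) (π : Fin n → ℤ) : Prop :=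
  ∀ v, (G.degree v : ℤ) = π v

/-- The list `π` of length `n` is graphic: it is the degree sequence of a simple graph. -/
def IsGraphic {n : ℕ} (π : Fin n → ℤ) : Prop :=
  ∃ G : SimpleGraph (Fin n), G.Realizes π

/-- The graph `G` contains `m` pairwise edge-disjoint 1-factors (perfect matchings). -/
def SimpleGraph.HasEdgeDisjointOneFactors {V : Type*} (G : SimpleGraph V) (m : ℕ) : Prop :=
  ∃ M : Fin m → G.Subgraph, (∀ i, (M i).IsPerfectMatching) ∧
    ∀ i j, i ≠ j → Disjoint (M i).edgeSet (M j).edgeSet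

/-!
By Kundu's theorem (`exists_nested`) the degree sequence `π` has a realization `G` with a `k`-factor.
Then `G` and its factors are changed by exchanges that keep all degrees in `G`, until enough perfect
matchings are split off.

The decomposition of `G` is a colouring of all pairs of vertices by natural numbers
(`IsFactored`): `0` for the non-edges, `2` for a regular factor, `3, 4, …` for the perfect matchings
found so far, `1` for the other edges. Only the degrees in each colour (`cdeg`) matter. The tool is
an exchange at two vertices `y` and `v`: for a set `W` of vertices on whose edges `y` and `v` see each
colour equally often, the colours of `y w` and `v w` are exchanged for all `w ∈ W`, which preserves
all colour degrees (`cdeg_exchange`). If `y x` has colour `h`, then such an exchange gives `v x` the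
colour `h`, unless there is a set of colours, containing that of `v x` but not `h`, which is closed
under passing from the colour of `y z` to that of `v z` (`exists_exchange_or_closed`). If all
colours but `0` and `1` are regular, then counting shows that this set contains exactly one of `0`
and `1`, and that `v` has a larger degree than `y` in it (`closed_cases`).

A permutation moving every vertex along an edge of colour `h` is a cover by cycles and single edges.
Even cycles split into single edges, and two odd cycles can be dissolved together once an edge of
colour `h` joins them, so a perfect matching of colour `h` exists as soon as two odd cycles can
always be joined in this way (`exists_involution_cover`; their number is even as `n` is). There are
two situations in which they can.

* `h = 1`, after the edges of a 2-factor of the regular part (`exists_two_factor`) have received the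
  colour `1`: choose `y` in one odd cycle and `v` in the other, so that the degree of `y` in the colour
  `0` is at least that of `v`; then the obstruction is impossible. This turns a `(2t + 2)`-factor
  into a `2t`-factor and a perfect matching (`IsFactored.exists_succ_of_two`).
* `h = 2`, with at most three perfect matchings so far. In an odd cycle the vertices cannot be
  alternately above and below a threshold, so some edge of one of the odd cycles has both ends at
  least as large, in terms of the degree in the colour `1`, as both ends of some edge of the other.
  The obstructions at these four vertices force the four edges between them to have four distinct
  colours of perfect matchings (`IsFactored.isMerging_two`). This turns an `(s + 1)`-factor into an
  `s`-factor and a perfect matching (`IsFactored.exists_succ_of_one`).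

Four steps of the second kind if `k` is even, and three if `k` is odd, followed by steps of the first
kind give `⌊k / 2⌋ + 2` perfect matchings.
-/

open Finset

namespace EdgeColouring

/-! ### Edge-colourings and exchanges at two vertices -/

section Exchange

variable {V K : Type*} [Fintype V] [DecidableEq V] [DecidableEq K]

/-- An edge-colouring of the complete graph on `V` is a symmetric function `c : V → V → K`, whose
values on the diagonal are ignored. `cdeg c κ v` is the degree of `v` in the colour class `κ`. -/
def cdeg (c : V → V → K) (κ : K) (v : V) : ℕ := #{z | z ≠ v ∧ c v z = κ}

/-- The colouring obtained from `c` by exchanging, for every `w ∈ W`, the colours of the two edges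
from `w` to `y` and to `v`. -/
def exchange (c : V → V → K) (y v : V) (W : Finset V) (p q : V) : K :=
  if p ∈ W then c p (Equiv.swap y v q) else if q ∈ W then c (Equiv.swap y v p) q else c p q

omit [Fintype V] [DecidableEq K] in
theorem exchange_symm {c : V → V → K} (hc : ∀ p q, c p q = c q p) {y v : V} {W : Finset V}
    (hy : y ∉ W) (hv : v ∉ W) (p q : V) : exchange c y v W p q = exchange c y v W q p := by
  have key : ∀ w ∈ W, Equiv.swap y v w = w := fun w hw =>
    Equiv.swap_apply_of_ne_of_ne (fun h => hy (h ▸ hw)) (fun h => hv (h ▸ hw))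
  unfold exchange
  by_cases hp : p ∈ W <;> by_cases hq : q ∈ W
  · rw [if_pos hp, if_pos hq, key p hp, key q hq, hc]
  · rw [if_pos hp, if_neg hq, if_pos hp, hc]
  · rw [if_neg hp, if_pos hq, if_pos hq, hc]
  · rw [if_neg hp, if_neg hq, if_neg hq, if_neg hp, hc]

theorem cdeg_exchange {c : V → V → K} {y v : V} {W : Finset V}
    (hy : y ∉ W) (hv : v ∉ W)
    (hW : ∀ κ, #{w ∈ W | c y w = κ} = #{w ∈ W | c v w = κ}) (κ : K) (p : V) :
    cdeg (exchange c y v W) κ p = cdeg c κ p := by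
  have split : ∀ f : V → K, ∀ u, u ∉ W → #{z | z ≠ u ∧ f z = κ} =
      #{w ∈ W | f w = κ} + #{z | z ∉ W ∧ z ≠ u ∧ f z = κ} := by
    intro f u hu
    rw [← card_union_of_disjoint]
    · congr 1; ext z
      simp only [mem_filter, mem_union, mem_univ, true_and]
      by_cases hz : z ∈ W
      · have : z ≠ u := fun h => hu (h ▸ hz)
        simp [hz, this]
      · simp [hz]
    · rw [disjoint_left]; intro z; simp only [mem_filter]; tauto
  unfold cdeg
  by_cases hp : p ∈ W
  · have hpy : p ≠ y := fun h => hy (h ▸ hp)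
    have hpv : p ≠ v := fun h => hv (h ▸ hp)
    refine card_bij (fun z _ => Equiv.swap y v z) ?_
      (fun a _ b _ h => (Equiv.swap y v).injective h) ?_
    · intro z hz
      simp only [mem_filter, mem_univ, true_and, exchange, hp, if_true] at hz ⊢
      refine ⟨fun h => hz.1 ?_, hz.2⟩
      rw [Equiv.swap_apply_eq_iff] at h
      rw [h, Equiv.swap_apply_of_ne_of_ne hpy hpv]
    · intro z hz
      simp only [mem_filter, mem_univ, true_and, exchange, hp, if_true] at hz ⊢
      refine ⟨Equiv.swap y v z, ⟨fun h => hz.1 ?_, by simpa using hz.2⟩, by simp⟩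
      rw [Equiv.swap_apply_eq_iff] at h
      rw [h, Equiv.swap_apply_of_ne_of_ne hpy hpv]
  · have h2 : ∀ z, exchange c y v W p z = if z ∈ W then c (Equiv.swap y v p) z else c p z := by
      intro z; simp [exchange, hp]
    simp only [h2]
    by_cases hpy : p = y
    · subst hpy
      rw [split _ p hp, split _ p hp, hW]
      congr 2
      · ext z; simp +contextual
      · ext z; simp +contextual
    by_cases hpv : p = v
    · subst hpv
      rw [split _ p hp, split _ p hp, ← hW]
      congr 2
      · ext z; simp +contextual
      · ext z; simp +contextual
    rw [Equiv.swap_apply_of_ne_of_ne hpy hpv]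
    simp

omit [Fintype V] in
theorem card_filter_insert_eq (f : V → K) {z : V} {W : Finset V} (hz : z ∉ W) (κ : K) :
    #{w ∈ insert z W | f w = κ} = #{w ∈ W | f w = κ} + if κ = f z then 1 else 0 := by
  rw [filter_insert]
  by_cases hk : f z = κ
  · rw [if_pos hk, if_pos hk.symm, card_insert_of_notMem (by simp [hz])]
  · rw [if_neg hk, if_neg (Ne.symm hk), add_zero]

omit [Fintype V] in
/-- A directed path from `a` to `b` in the multigraph whose arcs are `p z → q z` for `z` with
`P z` can be shortened to a simple one; the arcs `W` of it are balanced except at `a` and `b`. -/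
theorem exists_balanced_finset (p q : V → K) (P : V → Prop) {a b : K}
    (h : Relation.ReflTransGen (fun κ κ' => ∃ z, P z ∧ p z = κ ∧ q z = κ') a b) :
    ∃ W : Finset V, (∀ z ∈ W, P z ∧ p z ≠ b) ∧ ∀ κ,
      #{z ∈ W | p z = κ} + (if κ = b then 1 else 0) =
        #{z ∈ W | q z = κ} + (if κ = a then 1 else 0) := by
  -- `reach n` holds for the colours at the end of a walk of length `n` from `a`; the induction takes
  -- a walk of minimal length, whose vertices therefore lie in different layers.
  let reach : ℕ → K → Prop := fun n => n.rec (fun κ => κ = a)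
    (fun _ S κ' => ∃ z, P z ∧ S (p z) ∧ q z = κ')
  have key : ∀ n b, reach n b → (∀ m < n, ¬ reach m b) → ∃ W : Finset V,
      (∀ z ∈ W, P z ∧ ∃ m < n, reach m (p z)) ∧ ∀ κ,
      #{z ∈ W | p z = κ} + (if κ = b then 1 else 0) =
        #{z ∈ W | q z = κ} + (if κ = a then 1 else 0) := by
    intro n
    induction n with
    | zero =>
      intro b hb _
      have hb : b = a := hb
      subst hb
      exact ⟨∅, by simp, by simp⟩
    | succ n ih =>
      intro b hb hmin
      obtain ⟨z, hPz, hz, rfl⟩ : ∃ z, P z ∧ reach n (p z) ∧ q z = b := hb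
      have hminz : ∀ m < n, ¬ reach m (p z) := fun m hm hr =>
        hmin (m + 1) (by omega) ⟨z, hPz, hr, rfl⟩
      obtain ⟨W, hW, hbal⟩ := ih (p z) hz hminz
      have hzW : z ∉ W := fun hzW => by
        obtain ⟨_, m, hm, hr⟩ := hW z hzW
        exact hminz m hm hr
      refine ⟨insert z W, ?_, ?_⟩
      · intro w hw
        rcases mem_insert.1 hw with rfl | hw
        · exact ⟨hPz, n, by omega, hz⟩
        · obtain ⟨h1, m, hm, hr⟩ := hW w hw
          exact ⟨h1, m, by omega, hr⟩
      · intro κ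
        have h1 := hbal κ
        rw [card_filter_insert_eq p hzW, card_filter_insert_eq q hzW]; omega
  have hex : ∃ n, reach n b := by
    induction h with
    | refl => exact ⟨0, rfl⟩
    | tail _ hs ih =>
      obtain ⟨n, hn⟩ := ih
      obtain ⟨z, hP, h1, h2⟩ := hs
      exact ⟨n + 1, z, hP, h1 ▸ hn, h2⟩
  obtain ⟨n, hn, hmin⟩ : ∃ n, reach n b ∧ ∀ m < n, ¬ reach m b := by
    classical
    exact ⟨Nat.find hex, Nat.find_spec hex, fun m hm => Nat.find_min hex hm⟩
  obtain ⟨W, hW, hbal⟩ := key n b hn hmin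
  refine ⟨W, fun z hz => ⟨(hW z hz).1, ?_⟩, hbal⟩
  rintro rfl
  obtain ⟨m, hm, hr⟩ := (hW z hz).2
  exact hmin m hm hr

/-- The exchange lemma. If `y x` has the colour `h` and `v x` has not, then either the colour
degrees allow a recolouring in which `v x` gets the colour `h`, while no edge that avoids `v` and
`x` loses it, or a set `R` of colours that contains `c v x` but not `h` is an obstruction. -/
theorem exists_exchange_or_closed {c : V → V → K} (hc : ∀ p q, c p q = c q p) {y v x : V} {h : K}
    (hxy : x ≠ y) (hxv : x ≠ v) (hyx : c y x = h) :
    (∃ c' : V → V → K, (∀ p q, c' p q = c' q p) ∧ (∀ κ p, cdeg c' κ p = cdeg c κ p) ∧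
      c' v x = h ∧ ∀ p q, p ≠ v → p ≠ x → q ≠ v → q ≠ x → c p q = h → c' p q = h) ∨
    ∃ R : Set K, h ∉ R ∧ c v x ∈ R ∧ ∀ z, z ≠ y → z ≠ v → c y z ∈ R → c v z ∈ R := by
  -- A path of steps from `c v x` to `h` gives the set for the exchange, to which `x` is added; if there
  -- is none, the colours that can be reached form the obstruction.
  let step : K → K → Prop := fun κ κ' => ∃ z, (z ≠ y ∧ z ≠ v) ∧ c y z = κ ∧ c v z = κ'
  by_cases hr : Relation.ReflTransGen step (c v x) h
  · left
    obtain ⟨W, hW, hbal⟩ := exists_balanced_finset _ _ _ hr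
    have hxW : x ∉ W := fun hx => (hW x hx).2 hyx
    have hy : y ∉ insert x W := by
      rw [mem_insert]; rintro (rfl | hy)
      · exact hxy rfl
      · exact (hW y hy).1.1 rfl
    have hv : v ∉ insert x W := by
      rw [mem_insert]; rintro (rfl | hv)
      · exact hxv rfl
      · exact (hW v hv).1.2 rfl
    refine ⟨exchange c y v (insert x W), exchange_symm hc hy hv, cdeg_exchange hy hv ?_, ?_, ?_⟩
    · intro κ
      have h1 := hbal κ
      rwa [card_filter_insert_eq _ hxW, card_filter_insert_eq _ hxW, hyx]
    · simp [exchange, hv, hyx]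
    · intro p q hpv hpx hqv hqx hpq
      have key : ∀ p q, p ∈ W → q ≠ v → c p q = h → c p (Equiv.swap y v q) = h := by
        intro p q hp hqv hpq
        by_cases hqy : q = y
        · subst hqy
          exact absurd ((hc _ _).trans hpq) (hW p hp).2
        · rwa [Equiv.swap_apply_of_ne_of_ne hqy hqv]
      unfold exchange
      by_cases hp : p ∈ W
      · rw [if_pos (mem_insert_of_mem hp)]
        exact key p q hp hqv hpq
      · rw [if_neg (by simp [hp, hpx])]
        by_cases hq : q ∈ W
        · rw [if_pos (mem_insert_of_mem hq), hc]
          exact key q p hq hpv ((hc _ _).trans hpq)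
        · rwa [if_neg (by simp [hq, hqx])]
  · right
    exact ⟨{κ | Relation.ReflTransGen step (c v x) κ}, hr, .refl,
      fun z hzy hzv hz => Relation.ReflTransGen.tail hz ⟨z, ⟨hzy, hzv⟩, rfl, rfl⟩⟩

/-- If `y` and `v` have the same degree in all colours except `0` and `1`, then an obstruction `R`
to an exchange contains exactly one of the colours `0` and `1`, and `v` has the larger degree in
it. -/
theorem closed_cases {c : V → V → ℕ} (hc : ∀ p q, c p q = c q p) {y v x : V} {R : Set ℕ}
    (hyv : y ≠ v) (hxy : x ≠ y) (hxv : x ≠ v)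
    (hdeg : ∀ κ, 2 ≤ κ → cdeg c κ y = cdeg c κ v)
    (hx : c y x ∉ R) (hx' : c v x ∈ R) (hR : ∀ z, z ≠ y → z ≠ v → c y z ∈ R → c v z ∈ R) :
    (0 ∈ R ∧ 1 ∉ R ∧ cdeg c 0 y < cdeg c 0 v) ∨ (1 ∈ R ∧ 0 ∉ R ∧ cdeg c 1 y < cdeg c 1 v) := by
  classical
  -- the swap of `y` and `v` embeds the first set into the second one and misses `x`
  have hlt : #{z | z ≠ y ∧ c y z ∈ R} < #{z | z ≠ v ∧ c v z ∈ R} := by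
    rw [← card_map (Equiv.swap y v).toEmbedding]
    refine card_lt_card ((ssubset_iff_of_subset ?_).2 ⟨x, by simp [hx', hxv], ?_⟩)
    · intro w hw
      obtain ⟨z, hz, rfl⟩ := mem_map.1 hw
      simp only [mem_filter, mem_univ, true_and, Equiv.coe_toEmbedding] at hz ⊢
      by_cases hzv : z = v
      · subst hzv
        simpa [hyv, hc z y] using hz.2
      · rw [Equiv.swap_apply_of_ne_of_ne hz.1 hzv]
        exact ⟨hzv, hR z hz.1 hzv hz.2⟩
    · intro hxm
      obtain ⟨z, hz, hzx⟩ := mem_map.1 hxm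
      simp only [mem_filter, mem_univ, true_and, Equiv.coe_toEmbedding] at hz hzx
      rw [Equiv.swap_apply_eq_iff, Equiv.swap_apply_of_ne_of_ne hxy hxv] at hzx
      subst hzx
      exact hx hz.2
  obtain ⟨N, hN⟩ : ∃ N, ∀ p q, c p q < N + 2 :=
    ⟨univ.sup fun p => univ.sup fun q => c p q, fun p q => by
      have h1 : c p q ≤ univ.sup fun q => c p q := le_sup (f := fun q => c p q) (mem_univ q)
      have h2 := le_sup (f := fun p => univ.sup fun q => c p q) (mem_univ p)
      omega⟩
  have count : ∀ (S : Set ℕ) (u : V), #{z | z ≠ u ∧ c u z ∈ S} =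
      (∑ i ∈ range N, if i + 2 ∈ S then cdeg c (i + 2) u else 0) +
      (if 1 ∈ S then cdeg c 1 u else 0) + (if 0 ∈ S then cdeg c 0 u else 0) := by
    intro S u
    have : #{z | z ≠ u ∧ c u z ∈ S} = ∑ i ∈ range (N + 2), if i ∈ S then cdeg c i u else 0 := by
      rw [card_eq_sum_card_fiberwise (f := fun z => c u z) (t := range (N + 2))
        (fun z _ => by simpa using hN u z)]
      refine sum_congr rfl fun i _ => ?_
      rw [filter_filter]
      split_ifs with hi
      · unfold cdeg; congr 1; ext z
        simp only [mem_filter, mem_univ, true_and]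
        exact ⟨fun h => ⟨h.1.1, h.2⟩, fun h => ⟨⟨h.1, h.2 ▸ hi⟩, h.2⟩⟩
      · rw [card_eq_zero, filter_eq_empty_iff]
        rintro z - ⟨⟨_, h⟩, rfl⟩
        exact hi h
    rw [this, sum_range_succ', sum_range_succ']
  have htot : ∀ S : Set ℕ, (∀ κ, κ ∈ S) →
      #{z | z ≠ y ∧ c y z ∈ S} = #{z | z ≠ v ∧ c v z ∈ S} := by
    intro S hS
    simp only [hS, and_true, filter_ne', card_erase_of_mem, mem_univ]
  have hs : ∀ S : Set ℕ, (∑ i ∈ range N, if i + 2 ∈ S then cdeg c (i + 2) y else 0) =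
      ∑ i ∈ range N, if i + 2 ∈ S then cdeg c (i + 2) v else 0 := fun S =>
    sum_congr rfl fun i _ => by rw [hdeg (i + 2) (by omega)]
  replace htot := htot Set.univ Set.mem_univ
  rw [count, count, hs] at htot hlt
  simp only [Set.mem_univ, if_true] at htot
  by_cases h0 : 0 ∈ R <;> by_cases h1 : 1 ∈ R <;> simp only [h0, h1, if_true, if_false] at hlt ⊢ <;>
    simp <;> omega

end Exchange

/-! ### From permutations to fixed-point-free involutions -/

section Orbits

variable {V : Type*} [Fintype V] [DecidableEq V]

open Classical in
/-- The orbit of `x` under the permutation `φ`. -/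
def orbitFinset (φ : Equiv.Perm V) (x : V) : Finset V := {z | φ.SameCycle x z}

theorem mem_orbitFinset {φ : Equiv.Perm V} {x z : V} : z ∈ orbitFinset φ x ↔ φ.SameCycle x z := by
  simp [orbitFinset]

omit [DecidableEq V] in
theorem minimalPeriod_perm_pos (φ : Equiv.Perm V) (x : V) : 0 < Function.minimalPeriod φ x :=
  Function.minimalPeriod_pos_of_mem_periodicPts
    (Function.Injective.mem_periodicPts φ.injective x)

theorem orbitFinset_eq_image (φ : Equiv.Perm V) (x : V) :
    orbitFinset φ x = (range (Function.minimalPeriod φ x)).image fun i => φ^[i] x := by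
  ext z
  rw [mem_orbitFinset, mem_image]
  constructor
  · intro h
    obtain ⟨i, hi⟩ := h.exists_nat_pow_eq
    refine ⟨i % Function.minimalPeriod φ x,
      mem_range.2 (Nat.mod_lt _ (minimalPeriod_perm_pos φ x)), ?_⟩
    rw [Function.iterate_mod_minimalPeriod_eq, ← hi, ← Equiv.Perm.iterate_eq_pow]
  · rintro ⟨i, -, rfl⟩
    rw [Equiv.Perm.iterate_eq_pow]
    exact Equiv.Perm.SameCycle.refl φ x |>.trans (Equiv.Perm.sameCycle_pow_right.2 (.refl φ x))

theorem card_orbitFinset (φ : Equiv.Perm V) (x : V) :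
    #(orbitFinset φ x) = Function.minimalPeriod φ x := by
  rw [orbitFinset_eq_image, card_image_of_injOn, card_range]
  intro i hi j hj h
  exact Function.iterate_injOn_Iio_minimalPeriod (by simpa using hi) (by simpa using hj) h

theorem apply_mem_orbitFinset {φ : Equiv.Perm V} {x z : V} :
    φ z ∈ orbitFinset φ x ↔ z ∈ orbitFinset φ x := by
  rw [mem_orbitFinset, mem_orbitFinset, Equiv.Perm.sameCycle_apply_right]

theorem orbitFinset_eq {φ : Equiv.Perm V} {x z : V} (h : φ.SameCycle x z) :
    orbitFinset φ x = orbitFinset φ z := by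
  ext w
  rw [mem_orbitFinset, mem_orbitFinset]
  exact ⟨fun h' => h.symm.trans h', fun h' => h.trans h'⟩

/-- The last `m - e` vertices of an orbit of `m` vertices are paired up along the permutation, if
`m - e` is even. -/
theorem exists_pairing (φ : Equiv.Perm V) (x : V) (e : ℕ)
    (hm : Even (Function.minimalPeriod φ x + e)) (he : e ≤ 1) :
    ∃ g : V → V, ∀ z ∈ orbitFinset φ x, (e = 1 → z ≠ x) →
      g z ∈ orbitFinset φ x ∧ (e = 1 → g z ≠ x) ∧ g (g z) = z ∧ (φ z = g z ∨ φ (g z) = z) := by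
  set m := Function.minimalPeriod φ x with hm_def
  have hpos : 0 < m := minimalPeriod_perm_pos φ x
  have hinj : ∀ i < m, ∀ j < m, φ^[i] x = φ^[j] x → i = j := fun i hi j hj h =>
    Function.iterate_injOn_Iio_minimalPeriod hi hj h
  have hex : ∀ z, ∃ i, z ∈ orbitFinset φ x → i < m ∧ φ^[i] x = z := by
    intro z
    by_cases hz : z ∈ orbitFinset φ x
    · rw [orbitFinset_eq_image, mem_image] at hz
      obtain ⟨i, hi, h⟩ := hz
      exact ⟨i, fun _ => ⟨mem_range.1 hi, h⟩⟩
    · exact ⟨0, fun h => absurd h hz⟩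
  have hmem : ∀ i < m, φ^[i] x ∈ orbitFinset φ x := fun i hi => by
    rw [orbitFinset_eq_image]; exact mem_image_of_mem _ (mem_range.2 hi)
  choose idx hidx using hex
  have hidx' : ∀ i < m, idx (φ^[i] x) = i := fun i hi =>
    hinj _ (hidx _ (hmem i hi)).1 _ hi (hidx _ (hmem i hi)).2
  have hne : ∀ i < m, e ≤ i → e = 1 → φ^[i] x ≠ x := fun i hi h1 h2 h => by
    have := hinj i hi 0 hpos h
    omega
  -- the partner of the vertex with index `i` has index `j i`
  let j : ℕ → ℕ := fun i => if Even (i + e) then i + 1 else i - 1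
  refine ⟨fun z => φ^[j (idx z)] x, fun z hz hze => ?_⟩
  obtain ⟨him, hiz⟩ := hidx z hz
  set i := idx z
  have hei : e ≤ i := by
    rcases Nat.eq_zero_or_pos e with h | h
    · omega
    · by_contra hlt
      have h0 : i = 0 := by omega
      rw [h0] at hiz
      exact hze (by omega) hiz.symm
  have hj : j i < m ∧ e ≤ j i ∧ j (j i) = i ∧ (j i = i + 1 ∨ i = j i + 1) := by
    simp only [j]
    by_cases h : Even (i + e)
    · have h' : ¬ Even (i + 1 + e) := by
        rw [Nat.even_iff] at h ⊢; omega
      rw [if_pos h, if_neg h']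
      rw [Nat.even_iff] at h hm
      omega
    · have h1 : i ≠ 0 := by
        rintro h0
        have : e = 0 := by omega
        simp [h0, this] at h
      have h' : Even (i - 1 + e) := by
        rw [Nat.even_iff] at h ⊢; omega
      rw [if_neg h, if_pos h']
      rw [Nat.even_iff] at h hm
      omega
  refine ⟨hmem _ hj.1, hne _ hj.1 hj.2.1, ?_, ?_⟩
  · change φ^[j (idx (φ^[j i] x))] x = z
    rw [hidx' _ hj.1, hj.2.2.1, hiz]
  · change φ z = φ^[j i] x ∨ φ (φ^[j i] x) = z
    rcases hj.2.2.2 with h | h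
    · left; rw [h, Function.iterate_succ_apply', hiz]
    · right; rw [← Function.iterate_succ_apply' φ, ← hiz, Nat.succ_eq_add_one, ← h]

/-- If the vertices along an orbit can be coloured alternately, then the orbit is even. -/
theorem even_of_alternating (φ : Equiv.Perm V) (x : V) (f : V → Prop)
    (h : ∀ z ∈ orbitFinset φ x, (f (φ z) ↔ ¬ f z)) : Even #(orbitFinset φ x) := by
  rw [card_orbitFinset]
  have key : ∀ i, f (φ^[i] x) ↔ (Even i ↔ f x) := by
    intro i
    induction i with
    | zero => simp
    | succ i ih =>
      rw [Function.iterate_succ_apply', h, ih, Nat.even_add_one]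
      · tauto
      · rw [mem_orbitFinset, Equiv.Perm.iterate_eq_pow]
        exact Equiv.Perm.sameCycle_pow_right.2 (.refl φ x)
  have := key (Function.minimalPeriod φ x)
  rw [Function.iterate_minimalPeriod] at this
  tauto

/-- In a set of even size, odd orbits do not come alone. -/
theorem exists_second_odd_orbit (hV : Even (Fintype.card V)) (φ : Equiv.Perm V) (a : V)
    (ha : Odd #(orbitFinset φ a)) : ∃ b, ¬ φ.SameCycle a b ∧ Odd #(orbitFinset φ b) := by
  by_contra hcon
  push Not at hcon
  have h1 : Fintype.card V = ∑ S ∈ univ.image (orbitFinset φ), #S := by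
    rw [← card_univ, card_eq_sum_card_image (orbitFinset φ) univ]
    refine sum_congr rfl fun S hS => ?_
    obtain ⟨x, -, rfl⟩ := mem_image.1 hS
    congr 1; ext z
    simp only [mem_filter, mem_univ, true_and]
    refine ⟨fun h => h ▸ mem_orbitFinset.2 (.refl φ z), fun h => ?_⟩
    exact (orbitFinset_eq (mem_orbitFinset.1 h)).symm
  have h2 : Even (∑ S ∈ (univ.image (orbitFinset φ)).erase (orbitFinset φ a), #S) := by
    refine even_sum _ fun S hS => ?_
    obtain ⟨hne, hS⟩ := mem_erase.1 hS
    obtain ⟨x, -, rfl⟩ := mem_image.1 hS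
    exact Nat.not_odd_iff_even.1 (hcon x fun h => hne (orbitFinset_eq h).symm)
  rw [h1, ← add_sum_erase _ _ (mem_image_of_mem _ (mem_univ a)), Nat.even_add] at hV
  exact Nat.not_even_iff_odd.2 ha (hV.2 h2)

/-- Replacing a permutation on an invariant set by an involution. -/
theorem exists_perm_patch (φ : Equiv.Perm V) (S : Finset V) (hS : ∀ z, φ z ∈ S ↔ z ∈ S)
    (g : V → V) (hg : ∀ z ∈ S, g z ∈ S ∧ g (g z) = z) :
    ∃ ψ : Equiv.Perm V, (∀ z ∈ S, ψ z = g z) ∧ ∀ z ∉ S, ψ z = φ z := by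
  have hinj : Function.Injective fun z => if z ∈ S then g z else φ z := by
    intro p q hpq
    by_cases hp : p ∈ S <;> by_cases hq : q ∈ S <;> simp only [hp, hq, if_true, if_false] at hpq
    · rw [← (hg p hp).2, hpq, (hg q hq).2]
    · exact absurd (hpq ▸ (hg p hp).1) (fun h => hq ((hS q).1 h))
    · exact absurd (hpq ▸ (hg q hq).1) (fun h => hp ((hS p).1 h))
    · exact φ.injective hpq
  exact ⟨Equiv.ofBijective _ (Finite.injective_iff_bijective.1 hinj),
    fun z hz => by simp [hz], fun z hz => by simp [hz]⟩

/-- The permutation `φ` is a cycle cover, its 2-cycles being single edges, of the graph with the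
adjacency relation `A`. -/
def IsCover (A : V → V → Prop) (φ : Equiv.Perm V) : Prop := ∀ x, A x (φ x)

/-- A family of graphs is merging if, in a cycle cover of one of them, any two odd orbits can be
joined by an edge `y u` of another one that contains all edges of the first one outside `y` and
`u`. -/
def IsMerging (C : Set (V → V → Prop)) : Prop :=
  ∀ A ∈ C, ∀ φ : Equiv.Perm V, IsCover A φ → ∀ a b, ¬ φ.SameCycle a b →
    Odd #(orbitFinset φ a) → Odd #(orbitFinset φ b) →
    ∃ y u, φ.SameCycle a y ∧ φ.SameCycle b u ∧ ∃ A' ∈ C, A' y u ∧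
      ∀ p q, p ≠ y → p ≠ u → q ≠ y → q ≠ u → A p q → A' p q

/-- A cycle cover that is not a perfect matching can be replaced by one with more fixed points of
its square: an even orbit is split into edges, and an odd orbit is merged with a second one. -/
theorem exists_better_cover (hV : Even (Fintype.card V)) {C : Set (V → V → Prop)}
    (hsymm : ∀ A ∈ C, ∀ p q, A p q → A q p) (hirr : ∀ A ∈ C, ∀ p, ¬ A p p) (hC : IsMerging C)
    {A : V → V → Prop} (hA : A ∈ C) {φ : Equiv.Perm V} (hφ : IsCover A φ)
    {x : V} (hx : φ (φ x) ≠ x) :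
    ∃ A' ∈ C, ∃ ψ : Equiv.Perm V, IsCover A' ψ ∧
      #{z | φ (φ z) = z} < #{z | ψ (ψ z) = z} := by
  -- It suffices to find an involution along edges on an invariant set that contains `x`.
  suffices h : ∃ A' ∈ C, ∃ (S : Finset V) (g : V → V), (∀ z, φ z ∈ S ↔ z ∈ S) ∧ x ∈ S ∧
      (∀ z ∈ S, g z ∈ S ∧ g (g z) = z ∧ A' z (g z)) ∧ ∀ z ∉ S, A' z (φ z) by
    obtain ⟨A', hA', S, g, hS, hxS, hg, hout⟩ := h
    obtain ⟨ψ, h1, h2⟩ := exists_perm_patch φ S hS g fun z hz => ⟨(hg z hz).1, (hg z hz).2.1⟩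
    have hψ : ∀ z ∈ S, ψ (ψ z) = z := fun z hz => by
      rw [h1 z hz, h1 _ (hg z hz).1, (hg z hz).2.1]
    refine ⟨A', hA', ψ, fun z => ?_, ?_⟩
    · by_cases hz : z ∈ S
      · rw [h1 z hz]; exact (hg z hz).2.2
      · rw [h2 z hz]; exact hout z hz
    · refine card_lt_card ((ssubset_iff_of_subset ?_).2 ⟨x, by simp [hψ x hxS], by simp [hx]⟩)
      intro z hz
      simp only [mem_filter, mem_univ, true_and] at hz ⊢
      by_cases hzS : z ∈ S
      · exact hψ z hzS
      · rw [h2 z hzS, h2 _ (fun h => hzS ((hS z).1 h)), hz]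
  have hedge : ∀ z w, (φ z = w ∨ φ w = z) → A z w := by
    rintro z w (rfl | rfl)
    · exact hφ z
    · exact hsymm A hA _ _ (hφ w)
  rcases Nat.even_or_odd #(orbitFinset φ x) with hev | hodd
  · obtain ⟨g, hg⟩ := exists_pairing φ x 0 (by simpa [← card_orbitFinset] using hev) zero_le_one
    refine ⟨A, hA, orbitFinset φ x, g, fun z => apply_mem_orbitFinset,
      mem_orbitFinset.2 (.refl φ x), fun z hz => ?_, fun z _ => hφ z⟩
    obtain ⟨h1, -, h2, h3⟩ := hg z hz (by simp)
    exact ⟨h1, h2, hedge _ _ h3⟩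
  · obtain ⟨b, hxb, hb⟩ := exists_second_odd_orbit hV φ x hodd
    obtain ⟨y, u, hxy, hbu, A', hA', hyu, hAA'⟩ := hC A hA φ hφ x b hxb hodd hb
    rw [orbitFinset_eq hxy] at hodd
    rw [orbitFinset_eq hbu] at hb
    have hdisj : ∀ z, z ∈ orbitFinset φ y → z ∉ orbitFinset φ u := by
      intro z h1 h2
      rw [mem_orbitFinset] at h1 h2
      exact hxb (((hxy.trans h1).trans h2.symm).trans hbu.symm)
    have hyy : y ∈ orbitFinset φ y := mem_orbitFinset.2 (.refl φ y)
    have huu : u ∈ orbitFinset φ u := mem_orbitFinset.2 (.refl φ u)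
    have hyu_ne : y ≠ u := fun h => hirr A' hA' y (by rwa [← h] at hyu)
    rw [card_orbitFinset] at hodd hb
    obtain ⟨g₁, hg₁⟩ := exists_pairing φ y 1 hodd.add_one le_rfl
    obtain ⟨g₂, hg₂⟩ := exists_pairing φ u 1 hb.add_one le_rfl
    refine ⟨A', hA', orbitFinset φ y ∪ orbitFinset φ u,
      fun z => if z = y then u else if z = u then y else if z ∈ orbitFinset φ y then g₁ z else g₂ z,
      fun z => by simp only [mem_union, apply_mem_orbitFinset],
      mem_union_left _ (mem_orbitFinset.2 hxy.symm), fun z hz => ?_, fun z hz => ?_⟩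
    · by_cases hzy : z = y
      · subst hzy
        simp [hyu_ne.symm, huu, hyu]
      by_cases hzu : z = u
      · subst hzu
        simp [hzy, hyy, hsymm A' hA' _ _ hyu]
      simp only [hzy, hzu, if_false]
      by_cases hz1 : z ∈ orbitFinset φ y
      · obtain ⟨h1, h2, h3, h4⟩ := hg₁ z hz1 fun _ => hzy
        have hne : g₁ z ≠ u := fun h => hdisj _ h1 (h ▸ huu)
        simp only [hz1, if_true, h2 rfl, hne, if_false, h1, h3, mem_union, true_or, true_and]
        exact hAA' _ _ hzy hzu (h2 rfl) hne (hedge _ _ h4)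
      · have hz2 : z ∈ orbitFinset φ u := (mem_union.1 hz).resolve_left hz1
        obtain ⟨h1, h2, h3, h4⟩ := hg₂ z hz2 fun _ => hzu
        have hne : g₂ z ≠ y := fun h => hdisj _ hyy (h ▸ h1)
        have hnm : g₂ z ∉ orbitFinset φ y := fun h => hdisj _ h h1
        simp only [hz1, if_false, h2 rfl, hne, hnm, h1, h3, mem_union, or_true, true_and]
        exact hAA' _ _ hzy hzu hne (h2 rfl) (hedge _ _ h4)
    · rw [mem_union, not_or] at hz
      have h1 : φ z ∉ orbitFinset φ y := fun h => hz.1 (apply_mem_orbitFinset.1 h)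
      have h2 : φ z ∉ orbitFinset φ u := fun h => hz.2 (apply_mem_orbitFinset.1 h)
      exact hAA' _ _ (fun h => hz.1 (h ▸ hyy)) (fun h => hz.2 (h ▸ huu))
        (fun h => h1 (h ▸ hyy)) (fun h => h2 (h ▸ huu)) (hφ z)

/-- In a merging family, a cycle cover of one member gives a perfect matching of another. -/
theorem exists_involution_cover (hV : Even (Fintype.card V)) {C : Set (V → V → Prop)}
    (hsymm : ∀ A ∈ C, ∀ p q, A p q → A q p) (hirr : ∀ A ∈ C, ∀ p, ¬ A p p) (hC : IsMerging C)
    {A : V → V → Prop} (hA : A ∈ C) {φ : Equiv.Perm V} (hφ : IsCover A φ) :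
    ∃ A' ∈ C, ∃ ψ : Equiv.Perm V, IsCover A' ψ ∧ ∀ x, ψ (ψ x) = x := by
  induction hk : Fintype.card V - #{z | φ (φ z) = z} using Nat.strong_induction_on
    generalizing A φ with
  | _ k ih =>
    by_cases h : ∀ x, φ (φ x) = x
    · exact ⟨A, hA, φ, hφ, h⟩
    · push Not at h
      obtain ⟨x, hx⟩ := h
      obtain ⟨A', hA', ψ, hψ, hlt⟩ := exists_better_cover hV hsymm hirr hC hA hφ hx
      refine ih _ ?_ hA' hψ rfl
      have := card_le_univ ({z | ψ (ψ z) = z} : Finset V)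
      omega

end Orbits

/-! ### Regular relations and 2-factors -/

/-- Hall's theorem for a bipartite relation with degrees at least `d` on the left and at most `d`
on the right. -/
theorem exists_injective_of_regular {α β : Type*} [Fintype α] [Fintype β]
    (r : α → β → Prop) [∀ a, DecidablePred (r a)] {d : ℕ} (hd : 1 ≤ d)
    (hα : ∀ a, d ≤ #{b | r a b}) (hβ : ∀ b, #{a | r a b} ≤ d) :
    ∃ f : α → β, Function.Injective f ∧ ∀ a, r a (f a) := by
  classical
  rw [← Fintype.all_card_le_filter_rel_iff_exists_injective]
  intro A
  refine Nat.le_of_mul_le_mul_right (c := d) ?_ hd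
  refine card_mul_le_card_mul r (fun a ha => ?_) (fun b _ => ?_)
  · refine (hα a).trans (card_le_card fun b hb => ?_)
    simp only [mem_filter, mem_univ, true_and, mem_bipartiteAbove] at hb ⊢
    exact ⟨⟨a, ha, hb⟩, hb⟩
  · refine le_trans (card_le_card fun a ha => ?_) (hβ b)
    simp only [mem_filter, mem_univ, true_and, mem_bipartiteBelow] at ha ⊢
    exact ha.2

theorem exists_perm_of_regular {V : Type*} [Fintype V] (r : V → V → Prop)
    [∀ a, DecidablePred (r a)] {d : ℕ} (hd : 1 ≤ d)
    (h : ∀ a, d ≤ #{b | r a b}) (h' : ∀ b, #{a | r a b} ≤ d) :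
    ∃ φ : Equiv.Perm V, ∀ a, r a (φ a) := by
  obtain ⟨f, hf, hr⟩ := exists_injective_of_regular r hd h h'
  exact ⟨Equiv.ofBijective f (Finite.injective_iff_bijective.1 hf), hr⟩

/-- Petersen's 2-factor theorem. Hall's theorem, applied to edges and `t` copies of each vertex,
lets every edge choose one of its ends, so that no vertex is chosen more than `t` times; this
orients the graph, and a second application gives the permutation. -/
theorem exists_two_factor {V : Type*} [Fintype V] [DecidableEq V] (G : SimpleGraph V)
    [DecidableRel G.Adj] {t : ℕ} (ht : 1 ≤ t) (hG : ∀ v, G.degree v = 2 * t) :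
    ∃ φ : Equiv.Perm V, ∀ x, G.Adj x (φ x) ∧ φ (φ x) ≠ x := by
  obtain ⟨f, hf, hinc⟩ := exists_injective_of_regular (α := G.edgeFinset) (β := V × Fin t)
    (fun e b => b.1 ∈ e.1) (d := 2 * t) (by omega)
    (by
      rintro ⟨e, he⟩
      have hnd : ¬ e.IsDiag := G.not_isDiag_of_mem_edgeSet (SimpleGraph.mem_edgeFinset.1 he)
      have : ({b : V × Fin t | b.1 ∈ e} : Finset _) = e.toFinset ×ˢ univ := by
        ext b; simp
      simp only [this, card_product, Sym2.card_toFinset_of_not_isDiag e hnd, card_univ,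
        Fintype.card_fin, le_refl])
    (by
      rintro ⟨v, i⟩
      rw [← hG v, ← G.card_incidenceFinset_eq_degree]
      refine card_le_card_of_injOn (fun e => e.1) (fun e he => ?_)
        (fun a _ b _ h => Subtype.ext h)
      simp only [coe_filter, mem_univ, true_and, Set.mem_ofPred_eq] at he
      simp only [SimpleGraph.coe_incidenceFinset]
      exact ⟨SimpleGraph.mem_edgeFinset.1 e.2, he⟩)
  let E : ∀ {x y}, G.Adj x y → G.edgeFinset := fun {x y} h =>
    ⟨s(x, y), SimpleGraph.mem_edgeFinset.2 h⟩
  have hE : ∀ {x y} (h : G.Adj x y), E h = E h.symm := fun h => Subtype.ext Sym2.eq_swap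
  have hor : ∀ {x y} (h : G.Adj x y), (f (E h)).1 = x ∨ (f (E h)).1 = y := fun h =>
    Sym2.mem_iff.1 (hinc (E h))
  classical
  have hout : ∀ y, #{x | ∃ h : G.Adj x y, (f (E h)).1 = y} ≤ t := by
    intro y
    by_contra hlt
    obtain ⟨x, hx, x', hx', hne, heq⟩ := exists_ne_map_eq_of_card_lt_of_maps_to
      (t := (univ : Finset (Fin t)))
      (f := fun x => if h : G.Adj x y then (f (E h)).2 else ⟨0, ht⟩)
      (by simpa using hlt) (fun _ _ => by simp)
    simp only [mem_filter, mem_univ, true_and] at hx hx'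
    obtain ⟨h1, h2⟩ := hx
    obtain ⟨h1', h2'⟩ := hx'
    rw [dif_pos h1, dif_pos h1'] at heq
    have := congrArg Subtype.val (hf (Prod.ext (h2.trans h2'.symm) heq))
    exact hne (Sym2.congr_left.1 this)
  obtain ⟨φ, hφ⟩ := exists_perm_of_regular (fun x y => ∃ h : G.Adj x y, (f (E h)).1 = y) ht
    (fun x => by
      have h1 : G.degree x ≤ #{y | ∃ h : G.Adj x y, (f (E h)).1 = y} +
          #{y | ∃ h : G.Adj y x, (f (E h)).1 = x} := by
        rw [← G.card_neighborFinset_eq_degree]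
        refine le_trans (card_le_card fun y hy => ?_) (card_union_le _ _)
        rw [SimpleGraph.mem_neighborFinset] at hy
        simp only [mem_union, mem_filter, mem_univ, true_and]
        rcases hor hy with h | h
        · right; exact ⟨hy.symm, by rw [← hE hy]; exact h⟩
        · left; exact ⟨hy, h⟩
      have h2 := hout x
      rw [hG] at h1
      omega) hout
  refine ⟨φ, fun x => ⟨(hφ x).1, fun hx => ?_⟩⟩
  obtain ⟨h1, h2⟩ := hφ x
  obtain ⟨h3, h4⟩ := hφ (φ x)
  have : E h3 = E h1 := Subtype.ext (by
    show s(φ x, φ (φ x)) = s(x, φ x)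
    rw [hx, Sym2.eq_swap])
  rw [this, h2, hx] at h4
  exact h1.ne h4.symm

/-! ### Finding one more perfect matching -/

variable {V : Type*} [Fintype V] [DecidableEq V]

/-- The colouring `c` describes a graph with a partial factorization: `0` is the colour of the
non-edges, `2` that of an `s`-factor, `3, …, 2 + r` are the colours of `r` perfect matchings, `1` is
the colour of all other edges, and no further colours occur. -/
structure IsFactored (c : V → V → ℕ) (r s : ℕ) : Prop where
  symm : ∀ p q, c p q = c q p
  zero : ∀ κ, 3 + r ≤ κ → ∀ v, cdeg c κ v = 0
  two : ∀ v, cdeg c 2 v = s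
  matching : ∀ i < r, ∀ v, cdeg c (3 + i) v = 1

/-- Recolouring a `d`-regular subgraph `D` of the colour class `h` with the colour `m`. -/
theorem cdeg_recolour {c : V → V → ℕ} (D : V → V → Prop) [∀ p, DecidablePred (D p)] {h m d : ℕ}
    (hD : ∀ p q, D p q → p ≠ q ∧ c p q = h) (hd : ∀ p, #{q | D p q} = d) (κ : ℕ) (v : V) :
    cdeg (fun p q => if D p q then m else c p q) κ v + (if κ = h then d else 0) =
      cdeg c κ v + if κ = m then d else 0 := by
  have key : ∀ (f : V → ℕ) (l : ℕ), (∀ q, D v q → f q = l) → (∀ q, ¬ D v q → f q = c v q) →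
      #{q | q ≠ v ∧ f q = κ} =
        (if κ = l then d else 0) + #{q | ¬ D v q ∧ q ≠ v ∧ c v q = κ} := by
    intro f l h1 h2
    have h3 : (if κ = l then d else 0) = #{q | D v q ∧ κ = l} := by
      split_ifs with hl
      · simp [hl, hd]
      · simp [hl]
    rw [h3, ← card_union_of_disjoint]
    · congr 1; ext q
      simp only [mem_union, mem_filter, mem_univ, true_and]
      by_cases hq : D v q
      · simp [hq, h1 q hq, (hD v q hq).1.symm, eq_comm]
      · simp [hq, h2 q hq]
    · rw [disjoint_left]; intro q; simp only [mem_filter]; tauto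
  have e1 := key (fun q => if D v q then m else c v q) m (fun q hq => if_pos hq)
    (fun q hq => if_neg hq)
  have e2 := key (c v) h (fun q hq => (hD v q hq).2) (fun _ _ => rfl)
  simp only [cdeg] at e1 e2 ⊢
  omega

/-- The graphs that arise as the colour class `h` of a colouring with the same colour degrees as
`c`. -/
def colourClasses (c : V → V → ℕ) (h : ℕ) : Set (V → V → Prop) :=
  {A | ∃ c' : V → V → ℕ, (∀ p q, c' p q = c' q p) ∧ (∀ κ v, cdeg c' κ v = cdeg c κ v) ∧
    A = fun p q => p ≠ q ∧ c' p q = h}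

/-- If the graphs of colour `h` are merging and there is a cycle cover in this colour, then a
perfect matching of colour `h` can be found, after a recolouring, and given the colour `m`. -/
theorem exists_recoloured_matching (hV : Even (Fintype.card V)) {c : V → V → ℕ}
    (hc : ∀ p q, c p q = c q p) {h m : ℕ} (hC : IsMerging (colourClasses c h))
    {φ : Equiv.Perm V} (hφ : ∀ x, x ≠ φ x ∧ c x (φ x) = h) :
    ∃ c' : V → V → ℕ, (∀ p q, c' p q = c' q p) ∧ ∀ κ v,
      cdeg c' κ v + (if κ = h then 1 else 0) = cdeg c κ v + if κ = m then 1 else 0 := by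
  obtain ⟨A, ⟨c', hsymm, hdeg, rfl⟩, ψ, hψ, hinv⟩ := exists_involution_cover hV
    (C := colourClasses c h)
    (by rintro A ⟨c', hsymm, -, rfl⟩ p q ⟨h1, h2⟩; exact ⟨h1.symm, hsymm p q ▸ h2⟩)
    (by rintro A ⟨c', -, -, rfl⟩ p ⟨h1, -⟩; exact h1 rfl)
    hC ⟨c, hc, fun _ _ => rfl, rfl⟩ hφ
  refine ⟨fun p q => if q = ψ p then m else c' p q, fun p q => ?_, fun κ v => ?_⟩
  · have : q = ψ p ↔ p = ψ q := by
      constructor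
      · rintro rfl; exact (hinv p).symm
      · rintro rfl; exact (hinv q).symm
    simp only [this, hsymm p q]
  · rw [← hdeg]
    exact cdeg_recolour (fun p q => q = ψ p) (by rintro p q rfl; exact hψ p)
      (fun p => by simp [filter_eq']) κ v

/-- The exchange lemma together with the count of an obstruction, for a member `c` of the class of
colourings with the colour degrees of `c₀`. -/
theorem exists_merge_or_closed {c c₀ : V → V → ℕ} (hc : ∀ p q, c p q = c q p)
    (hc₀ : ∀ κ v, cdeg c κ v = cdeg c₀ κ v) {h : ℕ} {y v x : V} (hyv : y ≠ v) (hxy : x ≠ y)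
    (hxv : x ≠ v) (hyx : c y x = h) (hconst : ∀ κ, 2 ≤ κ → ∀ u v, cdeg c₀ κ u = cdeg c₀ κ v) :
    (∃ A' ∈ colourClasses c₀ h, A' v x ∧ A' x v ∧ ∀ p q, p ≠ v → p ≠ x → q ≠ v → q ≠ x →
      (p ≠ q ∧ c p q = h) → A' p q) ∨
    ∃ R : Set ℕ, h ∉ R ∧ c v x ∈ R ∧ (∀ z, z ≠ y → z ≠ v → c y z ∈ R → c v z ∈ R) ∧
      ((0 ∈ R ∧ 1 ∉ R ∧ cdeg c₀ 0 y < cdeg c₀ 0 v) ∨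
        (1 ∈ R ∧ 0 ∉ R ∧ cdeg c₀ 1 y < cdeg c₀ 1 v)) := by
  rcases exists_exchange_or_closed hc hxy hxv hyx with ⟨c', h1, h2, h3, h4⟩ | ⟨R, h1, h2, h3⟩
  · left
    exact ⟨_, ⟨c', h1, fun κ v => (h2 κ v).trans (hc₀ κ v), rfl⟩, ⟨hxv.symm, h3⟩,
      ⟨hxv, (h1 x v).trans h3⟩, fun p q hp hp' hq hq' h => ⟨h.1, h4 p q hp hp' hq hq' h.2⟩⟩
  · right
    refine ⟨R, h1, h2, h3, ?_⟩
    simp only [← hc₀] at hconst ⊢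
    exact closed_cases hc hyv hxy hxv (fun κ hκ => hconst κ hκ y v) (hyx ▸ h1) h2 h3

/-- If all colours but `0` and `1` are regular, then the colour class `1` is merging: the vertex whose
neighbour is taken over is chosen with the larger degree in the colour `0`, which excludes the
obstruction. -/
theorem isMerging_one {c₀ : V → V → ℕ}
    (hconst : ∀ κ, 2 ≤ κ → ∀ u v, cdeg c₀ κ u = cdeg c₀ κ v) :
    IsMerging (colourClasses c₀ 1) := by
  rintro A ⟨c, hc, hc₀, rfl⟩ φ hφ a b hab - -
  have key : ∀ y v, ¬ φ.SameCycle y v → cdeg c₀ 0 v ≤ cdeg c₀ 0 y →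
      ∃ A' ∈ colourClasses c₀ 1, A' v (φ y) ∧ A' (φ y) v ∧ ∀ p q, p ≠ v → p ≠ φ y → q ≠ v →
        q ≠ φ y → (p ≠ q ∧ c p q = 1) → A' p q := by
    intro y v hyv hle
    rcases exists_merge_or_closed hc hc₀ (h := 1) (y := y) (v := v) (x := φ y)
      (fun h => hyv (h ▸ .refl φ y)) (hφ y).1.symm
      (fun h => hyv (h ▸ Equiv.Perm.sameCycle_apply_right.2 (.refl φ y))) (hφ y).2 hconst with
      h | ⟨R, h1, -, -, h2⟩
    · exact h
    · rcases h2 with h2 | h2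
      · omega
      · exact absurd h2.1 h1
  rcases le_total (cdeg c₀ 0 b) (cdeg c₀ 0 a) with hle | hle
  · obtain ⟨A', hA', -, h1, h2⟩ := key a b hab hle
    exact ⟨φ a, b, Equiv.Perm.sameCycle_apply_right.2 (.refl φ a), .refl φ b, A', hA', h1,
      fun p q hp hp' hq hq' => h2 p q hp' hp hq' hq⟩
  · obtain ⟨A', hA', h1, -, h2⟩ := key b a (fun h => hab h.symm) hle
    exact ⟨a, φ b, .refl φ a, Equiv.Perm.sameCycle_apply_right.2 (.refl φ b), A', hA', h1, h2⟩

theorem IsFactored.const {c : V → V → ℕ} {r s : ℕ} (hF : IsFactored c r s) (κ : ℕ) (hκ : 2 ≤ κ)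
    (u v : V) : cdeg c κ u = cdeg c κ v := by
  rcases Nat.lt_or_ge κ (3 + r) with h | h
  · rcases Nat.lt_or_ge κ 3 with h' | h'
    · obtain rfl : κ = 2 := by omega
      rw [hF.two, hF.two]
    · obtain ⟨i, rfl⟩ := Nat.exists_eq_add_of_le h'
      rw [hF.matching i (by omega), hF.matching i (by omega)]
  · rw [hF.zero κ h, hF.zero κ h]

/-- Two units of regularity are traded for a perfect matching: a 2-factor of the regular part is
joined to the other edges, and the perfect matching is found there. -/
theorem IsFactored.exists_succ_of_two {c : V → V → ℕ} {r t : ℕ} (hV : Even (Fintype.card V))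
    (hF : IsFactored c r (2 * t + 2)) :
    ∃ c', IsFactored c' (r + 1) (2 * t) ∧ ∀ v, cdeg c' 0 v = cdeg c 0 v := by
  let G : SimpleGraph V :=
    { Adj := fun p q => p ≠ q ∧ c p q = 2
      symm := ⟨fun p q h => ⟨h.1.symm, hF.symm p q ▸ h.2⟩⟩
      loopless := ⟨fun p h => h.1 rfl⟩ }
  have : DecidableRel G.Adj := fun p q => inferInstanceAs (Decidable (p ≠ q ∧ c p q = 2))
  obtain ⟨φ, hφ⟩ := exists_two_factor G (t := t + 1) (by omega) (fun v => by
    rw [← G.card_neighborFinset_eq_degree, show 2 * (t + 1) = 2 * t + 2 by ring, ← hF.two v, cdeg]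
    congr 1; ext z
    simp only [SimpleGraph.mem_neighborFinset, mem_filter, mem_univ, true_and]
    exact ⟨fun h => ⟨h.1.symm, h.2⟩, fun h => ⟨h.1.symm, h.2⟩⟩)
  have h1 := cdeg_recolour (c := c) (fun p q => q = φ p ∨ p = φ q) (h := 2) (m := 1) (d := 2)
    (by
      rintro p q (rfl | rfl)
      · exact (hφ p).1
      · exact (hφ q).1.symm)
    (fun p => by
      have : ({q | q = φ p ∨ p = φ q} : Finset V) = {φ p, φ.symm p} := by
        ext q
        simp only [mem_filter, mem_univ, true_and, mem_insert, mem_singleton, Equiv.eq_symm_apply]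
        rw [eq_comm (a := p)]
      rw [this, card_pair]
      intro h
      exact (hφ p).2 (by rw [h, Equiv.apply_symm_apply]))
  set c₁ : V → V → ℕ := fun p q => if q = φ p ∨ p = φ q then 1 else c p q
  obtain ⟨c', hsymm, hdeg⟩ := exists_recoloured_matching hV (c := c₁) (h := 1) (m := 3 + r)
    (φ := φ) (fun p q => by simp only [c₁, or_comm, hF.symm p q])
    (isMerging_one fun κ hκ u v => by
      have h2 := h1 κ u
      have h3 := h1 κ v
      have h4 := hF.const κ hκ u v
      omega)
    (fun x => ⟨(hφ x).1.1, by simp [c₁]⟩)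
  refine ⟨c', ⟨hsymm, fun κ hκ v => ?_, fun v => ?_, fun i hi v => ?_⟩, fun v => ?_⟩
  · have h2 := h1 κ v
    have h3 := hdeg κ v
    have h4 := hF.zero κ (by omega) v
    split_ifs at h2 h3 <;> omega
  · have h2 := h1 2 v
    have h3 := hdeg 2 v
    have h4 := hF.two v
    split_ifs at h2 h3 <;> omega
  · have h2 := h1 (3 + i) v
    have h3 := hdeg (3 + i) v
    rcases Nat.lt_or_ge i r with h | h
    · have h4 := hF.matching i h v
      split_ifs at h2 h3 <;> omega
    · have h4 := hF.zero (3 + i) (by omega) v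
      split_ifs at h2 h3 <;> omega
  · have h2 := h1 0 v
    have h3 := hdeg 0 v
    rw [if_neg (by omega), if_neg (by omega)] at h2 h3
    omega

/-- Of two odd orbits of a permutation, one contains an edge both of whose ends have values at least
as large as the ends of some edge of the other. -/
theorem exists_edge_above_edge (φ : Equiv.Perm V) (f : V → ℕ) {a b : V}
    (ha : Odd #(orbitFinset φ a)) (hb : Odd #(orbitFinset φ b)) :
    ∃ p q, ((φ.SameCycle a p ∧ φ.SameCycle b q) ∨ (φ.SameCycle b p ∧ φ.SameCycle a q)) ∧
      max (f q) (f (φ q)) ≤ min (f p) (f (φ p)) := by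
  have key : ∀ a, Odd #(orbitFinset φ a) → ∃ p ∈ orbitFinset φ a, ∃ q ∈ orbitFinset φ a,
      max (f q) (f (φ q)) ≤ min (f p) (f (φ p)) := by
    intro a ha
    obtain ⟨p, hp, hmax⟩ := exists_max_image (orbitFinset φ a) (fun z => min (f z) (f (φ z)))
      ⟨a, mem_orbitFinset.2 (.refl φ a)⟩
    refine ⟨p, hp, ?_⟩
    by_contra! hcon
    refine Nat.not_even_iff_odd.2 ha (even_of_alternating φ a
      (fun z => min (f p) (f (φ p)) < f z) fun z hz => ?_)
    have h1 := hmax z hz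
    have h2 := hcon z hz
    omega
  obtain ⟨p, hp, q, hq, hpq⟩ := key a ha
  obtain ⟨p', hp', q', hq', hpq'⟩ := key b hb
  rw [mem_orbitFinset] at hp hq hp' hq'
  rcases le_total (min (f p) (f (φ p))) (min (f p') (f (φ p'))) with h | h
  · exact ⟨p', q, .inr ⟨hp', hq⟩, hpq.trans h⟩
  · exact ⟨p, q', .inl ⟨hp, hq'⟩, hpq'.trans h⟩

/-- With at most three perfect matchings, the colour class `2` is merging: if two odd orbits cannot
be merged, then the four edges between an edge of one orbit and a lower edge of the other have
distinct colours, all of them colours of perfect matchings. -/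
theorem IsFactored.isMerging_two {c₀ : V → V → ℕ} {r s : ℕ} (hF : IsFactored c₀ r s)
    (hr : r ≤ 3) : IsMerging (colourClasses c₀ 2) := by
  rintro A ⟨c, hc, hc₀, rfl⟩ φ hφ a b hab ha hb
  by_contra hno
  let X : V → V → Prop := fun p q =>
    (φ.SameCycle a p ∧ φ.SameCycle b q) ∨ (φ.SameCycle b p ∧ φ.SameCycle a q)
  have hXsymm : ∀ p q, X p q → X q p := fun p q h => h.elim (fun h => .inr ⟨h.2, h.1⟩)
    fun h => .inl ⟨h.2, h.1⟩
  have hXφ : ∀ p q, X p q → X (φ p) q := by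
    rintro p q (h | h)
    · exact .inl ⟨Equiv.Perm.sameCycle_apply_right.2 h.1, h.2⟩
    · exact .inr ⟨Equiv.Perm.sameCycle_apply_right.2 h.1, h.2⟩
  have hXne : ∀ p q, X p q → p ≠ q := by
    rintro p q (h | h) rfl
    · exact hab (h.1.trans h.2.symm)
    · exact hab (h.2.trans h.1.symm)
  have hX : ∀ p q, X p q → ¬ ∃ A' ∈ colourClasses c₀ 2, A' p q ∧ A' q p ∧
      ∀ p' q', p' ≠ p → p' ≠ q → q' ≠ p → q' ≠ q → (p' ≠ q' ∧ c p' q' = 2) → A' p' q' := by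
    rintro p q (h | h) ⟨A', hA', h1, h2, h3⟩
    · exact hno ⟨p, q, h.1, h.2, A', hA', h1, h3⟩
    · exact hno ⟨q, p, h.2, h.1, A', hA', h2, fun p' q' e1 e2 e3 e4 => h3 p' q' e2 e1 e4 e3⟩
  have hX2 : ∀ p q, X p q → c p q ≠ 2 := fun p q hpq h => hX p q hpq
    ⟨_, ⟨c, hc, hc₀, rfl⟩, ⟨hXne p q hpq, h⟩, ⟨(hXne p q hpq).symm, (hc q p).trans h⟩,
      fun _ _ _ _ _ _ h => h⟩
  -- The obstruction `R` at `y` and `v` contains `0` and the colour of `v x`, but neither `1` nor, since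
  -- it is closed and `v u` has the colour `2`, the colour of `y u`.
  have fact : ∀ y v x u, X y v → X x v → X y u → x ≠ y → u ≠ v → c y x = 2 → c v u = 2 →
      cdeg c₀ 1 v ≤ cdeg c₀ 1 y → c v x ≠ 1 ∧ c y u ≠ 0 ∧ c y u ≠ c v x := by
    intro y v x u hyv hxv hyu hxy huv hyx hvu hle
    rcases exists_merge_or_closed hc hc₀ (hXne y v hyv) hxy (hXne x v hxv) hyx hF.const with
      h | ⟨R, h1, h2, h3, h4⟩
    · exact absurd h (hX v x (hXsymm x v hxv))
    · rcases h4 with h4 | h4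
      · have hyuR : c y u ∉ R := fun h => h1 (hvu ▸ h3 u (hXne y u hyu).symm huv h)
        exact ⟨fun h => h4.2.1 (h ▸ h2), fun h => hyuR (h ▸ h4.1), fun h => hyuR (h ▸ h2)⟩
      · omega
  obtain ⟨x, u, hxu, hle⟩ := exists_edge_above_edge φ (cdeg c₀ 1) ha hb
  obtain ⟨⟨hx1, hx2⟩, ⟨hu1, hu2⟩⟩ := And.intro (hφ x) (hφ u)
  have hyu := hXφ x u hxu
  have hxw := hXsymm _ _ (hXφ u x (hXsymm _ _ hxu))
  have hyw := hXφ x _ hxw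
  set y := φ x
  set w := φ u
  have hy2 : c y x = 2 := (hc y x).trans hx2
  have hw2 : c w u = 2 := (hc w u).trans hu2
  have f1 := fact y w x u hyw hxw hyu hx1 hu1 hy2 hw2 (by omega)
  have f2 := fact x w y u hxw hyw hxu hx1.symm hu1 hx2 hw2 (by omega)
  have f3 := fact y u x w hyu hxu hyw hx1 hu1.symm hy2 hu2 (by omega)
  have f4 := fact x u y w hxu hyu hxw hx1.symm hu1.symm hx2 hu2 (by omega)
  have hlt : ∀ p q, X p q → c p q < 3 + r := by
    intro p q hpq
    by_contra! hge
    have := (hc₀ _ p).trans (hF.zero _ hge p)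
    rw [cdeg, card_eq_zero, filter_eq_empty_iff] at this
    exact this (mem_univ q) ⟨(hXne p q hpq).symm, rfl⟩
  have huniq : ∀ p q q', X p q → X p q' → q ≠ q' → 3 ≤ c p q → c p q ≠ c p q' := by
    intro p q q' hpq hpq' hne h3 heq
    have h1 := (hc₀ _ p).trans (hF.matching (c p q - 3) (by have := hlt p q hpq; omega) p)
    rw [cdeg, show 3 + (c p q - 3) = c p q by omega] at h1
    exact hne (card_le_one.1 h1.le q (by simp [(hXne p q hpq).symm]) q'
      (by simp [(hXne p q' hpq').symm, heq]))
  rw [hc w x] at f1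
  rw [hc w y] at f2
  rw [hc u x] at f3
  rw [hc u y] at f4
  have g1 := hX2 _ _ hxu
  have g2 := hX2 _ _ hxw
  have g3 := hX2 _ _ hyu
  have g4 := hX2 _ _ hyw
  have l1 := hlt _ _ hxu
  have l2 := hlt _ _ hxw
  have l3 := hlt _ _ hyu
  have l4 := hlt _ _ hyw
  have u1 := huniq x u w hxu hxw hu1 (by omega)
  have u2 := huniq y u w hyu hyw hu1 (by omega)
  have u3 := huniq u x y (hXsymm _ _ hxu) (hXsymm _ _ hyu) hx1 (by rw [hc]; omega)
  have u4 := huniq w x y (hXsymm _ _ hxw) (hXsymm _ _ hyw) hx1 (by rw [hc]; omega)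
  rw [hc u x, hc u y] at u3
  rw [hc w x, hc w y] at u4
  omega

/-- One unit of regularity is traded for a perfect matching, as long as there are at most three of
them. -/
theorem IsFactored.exists_succ_of_one {c : V → V → ℕ} {r s : ℕ} (hV : Even (Fintype.card V))
    (hr : r ≤ 3) (hF : IsFactored c r (s + 1)) :
    ∃ c', IsFactored c' (r + 1) s ∧ ∀ v, cdeg c' 0 v = cdeg c 0 v := by
  have hdeg2 : ∀ p, #{q | p ≠ q ∧ c p q = 2} = s + 1 := fun p => by
    rw [← hF.two p, cdeg]; simp only [ne_comm]
  obtain ⟨φ, hφ⟩ := exists_perm_of_regular (fun p q => p ≠ q ∧ c p q = 2) (d := s + 1) (by omega)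
    (fun p => (hdeg2 p).ge)
    (fun q => by rw [← hdeg2 q]; simp only [hF.symm q, ne_comm, le_refl])
  obtain ⟨c', hsymm, hdeg⟩ := exists_recoloured_matching hV (m := 3 + r) hF.symm
    (hF.isMerging_two hr) hφ
  refine ⟨c', ⟨hsymm, fun κ hκ v => ?_, fun v => ?_, fun i hi v => ?_⟩, fun v => ?_⟩
  · have h3 := hdeg κ v
    have h4 := hF.zero κ (by omega) v
    split_ifs at h3 <;> omega
  · have h3 := hdeg 2 v
    have h4 := hF.two v
    split_ifs at h3 <;> omega
  · have h3 := hdeg (3 + i) v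
    rcases Nat.lt_or_ge i r with h | h
    · have h4 := hF.matching i h v
      split_ifs at h3 <;> omega
    · have h4 := hF.zero (3 + i) (by omega) v
      split_ifs at h3 <;> omega
  · have h3 := hdeg 0 v
    rw [if_neg (by omega), if_neg (by omega)] at h3
    omega

/-- Starting from a `k`-factor, one obtains `⌊k / 2⌋ + 2` perfect matchings: while there are at
most three of them, each costs one unit of regularity, or else two. -/
theorem IsFactored.exists_half_add_two {c : V → V → ℕ} {k : ℕ} (hV : Even (Fintype.card V))
    (hk : 3 ≤ k) (hF : IsFactored c 0 k) :
    ∃ c', IsFactored c' (k / 2 + 2) 0 ∧ ∀ v, cdeg c' 0 v = cdeg c 0 v := by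
  have ones : ∀ j ≤ 4, j ≤ k → ∃ c', IsFactored c' j (k - j) ∧ ∀ v, cdeg c' 0 v = cdeg c 0 v := by
    intro j
    induction j with
    | zero => exact fun _ _ => ⟨c, hF, fun _ => rfl⟩
    | succ j ih =>
      intro hj hjk
      obtain ⟨c', h1, h2⟩ := ih (by omega) (by omega)
      rw [show k - j = k - (j + 1) + 1 by omega] at h1
      obtain ⟨c'', h3, h4⟩ := h1.exists_succ_of_one hV (by omega)
      exact ⟨c'', h3, fun v => (h4 v).trans (h2 v)⟩
  have twos : ∀ t r (c₁ : V → V → ℕ), IsFactored c₁ r (2 * t) →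
      ∃ c', IsFactored c' (r + t) 0 ∧ ∀ v, cdeg c' 0 v = cdeg c₁ 0 v := by
    intro t
    induction t with
    | zero => exact fun r c₁ h => ⟨c₁, h, fun _ => rfl⟩
    | succ t ih =>
      intro r c₁ h
      obtain ⟨c', h1, h2⟩ := IsFactored.exists_succ_of_two (t := t) hV h
      obtain ⟨c'', h3, h4⟩ := ih _ _ h1
      exact ⟨c'', by rwa [show r + (t + 1) = r + 1 + t by omega], fun v => (h4 v).trans (h2 v)⟩
  -- three or four single steps, so that the remaining degree is even
  obtain ⟨j, t, hj, hjk, ht, hr⟩ : ∃ j t, j ≤ 4 ∧ j ≤ k ∧ k - j = 2 * t ∧ j + t = k / 2 + 2 := by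
    rcases Nat.even_or_odd' k with ⟨m, h | h⟩
    · exact ⟨4, m - 2, by omega, by omega, by omega, by omega⟩
    · exact ⟨3, m - 1, by omega, by omega, by omega, by omega⟩
  obtain ⟨c₁, h1, h2⟩ := ones j hj hjk
  rw [ht] at h1
  obtain ⟨c', h3, h4⟩ := twos t j c₁ h1
  exact ⟨c', hr ▸ h3, fun v => (h4 v).trans (h2 v)⟩

/-! ### Kundu's theorem -/

/-- Exchanging the edges of an alternating 4-cycle `y, y', z', z`, where `y y'` and `z' z` have the
colour `b` while `y z` and `z' y'` have the other one. The relation `Q` stands for a property that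
makes it harmless for `y y'` and `z' z` to change their colour. -/
theorem exists_switch {c : V → V → Bool} (hc : ∀ p q, c p q = c q p) (b : Bool) {y y' z z' : V}
    (hyz' : y ≠ z') (hy'z : y' ≠ z) (hyy' : y ≠ y') (hyz : y ≠ z) (hz'y' : z' ≠ y') (hz'z : z' ≠ z)
    (h1 : c y y' = b) (h2 : c z' z = b) (h3 : c y z = !b) (h4 : c z' y' = !b)
    (Q : V → V → Prop) (hQ : ∀ p q, Q p q → Q q p) (hQ1 : Q y y') (hQ2 : Q z' z) :
    ∃ c' : V → V → Bool, (∀ p q, c' p q = c' q p) ∧ (∀ κ v, cdeg c' κ v = cdeg c κ v) ∧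
      c' y z = b ∧ ∀ p q, c' p q = (!b) → c p q = (!b) ∨ Q p q := by
  have hy : y ∉ ({y', z} : Finset V) := by simp [hyy', hyz]
  have hz' : z' ∉ ({y', z} : Finset V) := by simp [hz'y', hz'z]
  have hsymm := exchange_symm hc hy hz'
  refine ⟨exchange c y z' {y', z}, hsymm, cdeg_exchange hy hz' fun κ => ?_, ?_, ?_⟩
  · rw [card_filter_insert_eq _ (by simpa using hy'z), card_filter_insert_eq _ (by simpa using hy'z),
      h1, h4, filter_singleton, filter_singleton, h2, h3]
    cases b <;> cases κ <;> simp
  · simp [exchange, hyy', hyz, h2]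
  · have key : ∀ p ∈ ({y', z} : Finset V), ∀ q, exchange c y z' {y', z} p q = (!b) →
        c p q = (!b) ∨ Q p q := by
      intro p hp q h
      rw [exchange, if_pos hp] at h
      by_cases hqy : q = y
      · subst hqy
        rw [Equiv.swap_apply_left] at h
        rcases mem_insert.1 hp with rfl | hp
        · exact .inr (hQ _ _ hQ1)
        · rw [mem_singleton.1 hp, hc, h2] at h
          simp at h
      by_cases hqz : q = z'
      · subst hqz
        rw [Equiv.swap_apply_right] at h
        rcases mem_insert.1 hp with rfl | hp
        · rw [hc, h1] at h
          simp at h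
        · rw [mem_singleton.1 hp]
          exact .inr (hQ _ _ hQ2)
      rw [Equiv.swap_apply_of_ne_of_ne hqy hqz] at h
      exact .inl h
    intro p q h
    by_cases hp : p ∈ ({y', z} : Finset V)
    · exact key p hp q h
    by_cases hq : q ∈ ({y', z} : Finset V)
    · rw [hsymm] at h
      exact (key q hq p h).imp (fun h => (hc p q).trans h) (hQ _ _)
    · rw [exchange, if_neg hp, if_neg hq] at h
      exact .inl h

/-- The pairs that are edges of `a` but not of `g`. -/
def badPairs (g a : V → V → Bool) : Finset (V × V) :=
  {p | p.1 ≠ p.2 ∧ a p.1 p.2 = true ∧ g p.1 p.2 = false}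

/-- If the degrees in `g` exceed those in `a` by a positive constant, then one of the two graphs has
a switch that leaves fewer edges of `a` outside `g`. The vertex `y` is chosen on most edges of
`a` outside `g`; if no switch helps, the vertex `z'` is on even more of them. -/
theorem exists_fewer_badPairs {g a : V → V → Bool} (hg : ∀ p q, g p q = g q p)
    (ha : ∀ p q, a p q = a q p) {k : ℕ} (hk : 1 ≤ k)
    (hdeg : ∀ v, cdeg g true v = cdeg a true v + k) (hbad : (badPairs g a).Nonempty) :
    ∃ g' a' : V → V → Bool, (∀ p q, g' p q = g' q p) ∧ (∀ p q, a' p q = a' q p) ∧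
      (∀ v, cdeg g' true v = cdeg g true v) ∧ (∀ v, cdeg a' true v = cdeg a true v) ∧
      #(badPairs g' a') < #(badPairs g a) := by
  let F : V → Finset V := fun v => {w | w ≠ v ∧ g v w = true ∧ a v w = false}
  let R : V → Finset V := fun v => {w | w ≠ v ∧ a v w = true ∧ g v w = false}
  have hFR : ∀ v, #(F v) = #(R v) + k := by
    intro v
    have e1 : cdeg g true v = #(F v) + #{w | w ≠ v ∧ g v w = true ∧ a v w = true} := by
      rw [cdeg, ← card_union_of_disjoint]
      · congr 1; ext w
        simp only [F, mem_union, mem_filter, mem_univ, true_and]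
        cases a v w <;> simp
      · rw [disjoint_left]; intro w; simp +contextual [F]
    have e2 : cdeg a true v = #(R v) + #{w | w ≠ v ∧ g v w = true ∧ a v w = true} := by
      rw [cdeg, ← card_union_of_disjoint]
      · congr 1; ext w
        simp only [R, mem_union, mem_filter, mem_univ, true_and]
        cases g v w <;> simp
      · rw [disjoint_left]; intro w; simp +contextual [R]
    have := hdeg v
    omega
  obtain ⟨⟨y₀, z₀⟩, h₀⟩ := hbad
  simp only [badPairs, mem_filter, mem_univ, true_and] at h₀
  -- `y z` is in `a` but not in `g`, and `z z'` is in `g` but not in `a`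
  obtain ⟨y, -, hmax⟩ := exists_max_image univ (fun v => #(R v)) ⟨y₀, mem_univ _⟩
  obtain ⟨z, hz⟩ : (R y).Nonempty := by
    rw [← card_pos]
    refine lt_of_lt_of_le (card_pos.2 ⟨z₀, ?_⟩) (hmax y₀ (mem_univ _))
    simp [R, h₀, h₀.1.symm]
  obtain ⟨z', hz'⟩ : (F z).Nonempty := by
    rw [← card_pos, hFR]; omega
  simp only [R, mem_filter, mem_univ, true_and] at hz
  simp only [F, mem_filter, mem_univ, true_and] at hz'
  obtain ⟨hzy, hayz, hgyz⟩ := hz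
  obtain ⟨hz'z, hgzz', hazz'⟩ := hz'
  have hyz' : y ≠ z' := by
    rintro rfl
    rw [ha, hayz] at hazz'
    simp at hazz'
  by_contra hno
  -- otherwise a switch along the 4-cycle `y, y', z', z` in `g` or in `a` would help
  have claim : ∀ y' ∈ F y, y' ≠ z' → y' ∈ F z' := by
    intro y' hy' hne
    simp only [F, mem_filter, mem_univ, true_and] at hy' ⊢
    obtain ⟨hy'y, hgyy', hayy'⟩ := hy'
    have hy'z : y' ≠ z := by
      rintro rfl
      rw [hayz] at hayy'
      simp at hayy'
    refine ⟨hne, ?_, ?_⟩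
    · by_contra hgf
      obtain ⟨g', h1, h2, h3, h4⟩ := exists_switch hg true hyz' hy'z hy'y.symm hzy.symm hne.symm hz'z
        hgyy' ((hg _ _).trans hgzz') hgyz (by simpa using hgf) (fun p q => a p q = false)
        (fun p q h => (ha q p).trans h) hayy' ((ha _ _).trans hazz')
      refine hno ⟨g', a, h1, ha, fun v => h2 _ v, fun _ => rfl,
        card_lt_card ((ssubset_iff_of_subset ?_).2 ⟨(y, z), ?_, ?_⟩)⟩
      · rintro ⟨p, q⟩ hpq
        simp only [badPairs, mem_filter, mem_univ, true_and] at hpq ⊢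
        refine ⟨hpq.1, hpq.2.1, (h4 p q hpq.2.2).resolve_right fun h => ?_⟩
        rw [hpq.2.1] at h
        simp at h
      · simp [badPairs, hzy.symm, hayz, hgyz]
      · simp [badPairs, h3]
    · by_contra haf
      obtain ⟨a', h1, h2, h3, h4⟩ := exists_switch ha false hyz' hy'z hy'y.symm hzy.symm hne.symm
        hz'z hayy' ((ha _ _).trans hazz') hayz (by simpa using haf) (fun p q => g p q = true)
        (fun p q h => (hg q p).trans h) hgyy' ((hg _ _).trans hgzz')
      refine hno ⟨g, a', hg, h1, fun _ => rfl, fun v => h2 _ v,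
        card_lt_card ((ssubset_iff_of_subset ?_).2 ⟨(y, z), ?_, ?_⟩)⟩
      · rintro ⟨p, q⟩ hpq
        simp only [badPairs, mem_filter, mem_univ, true_and] at hpq ⊢
        refine ⟨hpq.1, (h4 p q hpq.2.1).resolve_right fun h => ?_, hpq.2.2⟩
        rw [hpq.2.2] at h
        simp at h
      · simp [badPairs, hzy.symm, hayz, hgyz]
      · simp [badPairs, h3]
  have hzF : z ∉ (F y).map (Equiv.swap y z').toEmbedding := by
    intro h
    obtain ⟨w, hw, hwz⟩ := mem_map.1 h
    rw [Equiv.coe_toEmbedding, Equiv.swap_apply_eq_iff,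
      Equiv.swap_apply_of_ne_of_ne hzy hz'z.symm] at hwz
    simp [F, hwz, hayz] at hw
  have hsub : insert z ((F y).map (Equiv.swap y z').toEmbedding) ⊆ F z' := by
    intro w hw
    rcases mem_insert.1 hw with rfl | hw
    · simp only [F, mem_filter, mem_univ, true_and]
      exact ⟨hz'z.symm, (hg _ _).trans hgzz', (ha _ _).trans hazz'⟩
    · obtain ⟨u, hu, rfl⟩ := mem_map.1 hw
      rw [Equiv.coe_toEmbedding]
      by_cases huz : u = z'
      · subst huz
        rw [Equiv.swap_apply_right]
        simp only [F, mem_filter, mem_univ, true_and] at hu ⊢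
        exact ⟨hyz', (hg _ _).trans hu.2.1, (ha _ _).trans hu.2.2⟩
      · have huy : u ≠ y := by
          simp only [F, mem_filter, mem_univ, true_and] at hu
          exact hu.1
        rw [Equiv.swap_apply_of_ne_of_ne huy huz]
        exact claim u hu huz
  have h1 := card_le_card hsub
  rw [card_insert_of_notMem hzF, card_map, hFR, hFR] at h1
  have h2 := hmax z' (mem_univ _)
  omega

/-- Kundu's theorem for a regular difference: if the degrees in `g` exceed those in `a` by the
constant `k`, then both degree sequences have realizations one of which contains the other. -/
theorem exists_nested {g a : V → V → Bool} (hg : ∀ p q, g p q = g q p)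
    (ha : ∀ p q, a p q = a q p) {k : ℕ} (hk : 1 ≤ k)
    (hdeg : ∀ v, cdeg g true v = cdeg a true v + k) :
    ∃ g' a' : V → V → Bool, (∀ p q, g' p q = g' q p) ∧ (∀ p q, a' p q = a' q p) ∧
      (∀ v, cdeg g' true v = cdeg g true v) ∧ (∀ v, cdeg a' true v = cdeg a true v) ∧
      ∀ p q, p ≠ q → a' p q = true → g' p q = true := by
  induction hn : #(badPairs g a) using Nat.strong_induction_on generalizing g a with
  | _ n ih =>
    rcases (badPairs g a).eq_empty_or_nonempty with h | h
    · refine ⟨g, a, hg, ha, fun _ => rfl, fun _ => rfl, fun p q hne hpq => ?_⟩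
      by_contra hgf
      have : (p, q) ∈ badPairs g a := by
        simpa [badPairs, hne, hpq] using hgf
      simp [h] at this
    · obtain ⟨g₁, a₁, h1, h2, h3, h4, h5⟩ := exists_fewer_badPairs hg ha hk hdeg h
      obtain ⟨g', a', e1, e2, e3, e4, e5⟩ := ih _ (hn ▸ h5) h1 h2
        (fun v => by rw [h3, h4, hdeg]) rfl
      exact ⟨g', a', e1, e2, fun v => (e3 v).trans (h3 v), fun v => (e4 v).trans (h4 v), e5⟩

/-! ### From colourings to graphs -/

theorem card_ne_add_cdeg {K : Type*} [DecidableEq K] (c : V → V → K) (κ : K) (v : V) :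
    #{z | z ≠ v ∧ c v z ≠ κ} + cdeg c κ v + 1 = Fintype.card V := by
  have h1 : #{z | z ≠ v ∧ c v z ≠ κ} + cdeg c κ v = #(univ.erase v) := by
    rw [cdeg, ← card_union_of_disjoint]
    · congr 1; ext z
      simp only [mem_union, mem_filter, mem_univ, true_and, mem_erase, and_true]
      tauto
    · rw [disjoint_left]; intro z; simp +contextual
  rw [h1, card_erase_add_one (mem_univ v), card_univ]

/-- Kundu's theorem in terms of colourings. -/
theorem exists_isFactored (G A : SimpleGraph V) [DecidableRel G.Adj] [DecidableRel A.Adj] {k : ℕ}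
    (hk : 1 ≤ k) (hdeg : ∀ v, G.degree v = A.degree v + k) :
    ∃ c : V → V → ℕ, IsFactored c 0 k ∧
      ∀ v, G.degree v + cdeg c 0 v + 1 = Fintype.card V := by
  have hcd : ∀ (H : SimpleGraph V) [DecidableRel H.Adj] (v : V),
      cdeg (fun p q => decide (H.Adj p q)) true v = H.degree v := by
    intro H _ v
    rw [← H.card_neighborFinset_eq_degree, cdeg]
    congr 1; ext z
    simp only [mem_filter, mem_univ, true_and, decide_eq_true_eq, SimpleGraph.mem_neighborFinset]
    exact ⟨fun h => h.2, fun h => ⟨h.ne', h⟩⟩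
  obtain ⟨g, a, hg, ha, hgd, had, hsub⟩ := exists_nested
    (g := fun p q => decide (G.Adj p q)) (a := fun p q => decide (A.Adj p q))
    (fun p q => by simp only [G.adj_comm]) (fun p q => by simp only [A.adj_comm]) hk
    (fun v => by rw [hcd, hcd, hdeg])
  simp only [hcd] at hgd had
  let c : V → V → ℕ := fun p q => if g p q then if a p q then 1 else 2 else 0
  have hval : ∀ p q, c p q ≤ 2 := by
    intro p q
    simp only [c]
    split_ifs <;> omega
  refine ⟨c, ⟨fun p q => by simp only [c, hg p q, ha p q], fun κ hκ v => ?_, fun v => ?_,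
    fun i hi => by omega⟩, fun v => ?_⟩
  · rw [cdeg, card_eq_zero, filter_eq_empty_iff]
    rintro z - ⟨-, h⟩
    have := hval v z
    omega
  · have : cdeg g true v = cdeg a true v + cdeg c 2 v := by
      unfold cdeg
      rw [← card_union_of_disjoint]
      · congr 1; ext z
        simp only [mem_union, mem_filter, mem_univ, true_and, c]
        by_cases hz : z = v
        · simp [hz]
        · have := hsub v z (Ne.symm hz)
          cases h1 : g v z <;> cases h2 : a v z <;> simp_all
      · rw [disjoint_left]; intro z
        simp only [mem_filter, mem_univ, true_and, c]
        rintro ⟨-, h1⟩ ⟨-, h2⟩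
        simp only [h1, if_true] at h2
        split_ifs at h2
        all_goals omega
    rw [hgd, had, hdeg] at this
    omega
  · rw [← hgd v, ← card_ne_add_cdeg c 0 v, cdeg]
    congr 3; ext z
    simp only [mem_filter, mem_univ, true_and, c]
    cases g v z <;> cases a v z <;> simp

/-- A colouring that describes `r` perfect matchings gives a graph that contains them. -/
theorem IsFactored.exists_graph {c : V → V → ℕ} {r s : ℕ} (hF : IsFactored c r s) :
    ∃ G : SimpleGraph V, G.HasEdgeDisjointOneFactors r ∧
      ∀ (v : V) [Fintype (G.neighborSet v)], G.degree v + cdeg c 0 v + 1 = Fintype.card V := by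
  let G : SimpleGraph V :=
    { Adj := fun p q => p ≠ q ∧ c p q ≠ 0
      symm := ⟨fun p q h => ⟨h.1.symm, hF.symm p q ▸ h.2⟩⟩
      loopless := ⟨fun p h => h.1 rfl⟩ }
  let M : Fin r → G.Subgraph := fun i =>
    { verts := Set.univ
      Adj := fun p q => p ≠ q ∧ c p q = 3 + i
      adj_sub := fun {p q} h => ⟨h.1, by have := h.2; omega⟩
      edge_vert := fun _ => Set.mem_univ _
      symm := ⟨fun p q h => ⟨h.1.symm, hF.symm p q ▸ h.2⟩⟩ }
  refine ⟨G, ⟨M, fun i => ⟨fun v _ => ?_, fun v => Set.mem_univ v⟩, fun i j hij => ?_⟩, ?_⟩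
  · obtain ⟨w, hw⟩ := card_eq_one.1 (hF.matching i i.2 v)
    simp only [Finset.ext_iff, mem_filter, mem_univ, true_and, mem_singleton] at hw
    exact ⟨w, ⟨((hw w).2 rfl).1.symm, ((hw w).2 rfl).2⟩, fun u hu => (hw u).1 ⟨hu.1.symm, hu.2⟩⟩
  · rw [Set.disjoint_left]
    intro e
    induction e using Sym2.ind with
    | _ p q =>
      intro h1 h2
      rw [SimpleGraph.Subgraph.mem_edgeSet] at h1 h2
      have h3 : 3 + (i : ℕ) = 3 + j := h1.2.symm.trans h2.2
      exact hij (Fin.ext (by omega))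
  · intro v _
    rw [← card_ne_add_cdeg c 0 v, ← G.card_neighborFinset_eq_degree]
    congr 3; ext z
    simp only [SimpleGraph.mem_neighborFinset, mem_filter, mem_univ, true_and]
    exact ⟨fun h => ⟨h.1.symm, h.2⟩, fun h => ⟨h.1.symm, h.2⟩⟩

end EdgeColouring

theorem theorem4 (n k : ℕ) (hn : Even n) (hk : 3 ≤ k) (π : Fin n → ℤ)
    (hπ : IsGraphic π) (hπk : IsGraphic (fun i => π i - (k : ℤ))) :
    ∃ G : SimpleGraph (Fin n), G.Realizes π ∧ G.HasEdgeDisjointOneFactors (k / 2 + 2) := by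
  classical
  obtain ⟨G, hG⟩ := hπ
  obtain ⟨A, hA⟩ := hπk
  have hdeg : ∀ v, G.degree v = A.degree v + k := by
    intro v
    have h1 : (G.degree v : ℤ) = π v := by convert hG v
    have h2 : (A.degree v : ℤ) = π v - k := by convert hA v
    omega
  obtain ⟨c, hc, h0⟩ := EdgeColouring.exists_isFactored G A (by omega) hdeg
  obtain ⟨c', hc', h0'⟩ := hc.exists_half_add_two (by simpa using hn) hk
  obtain ⟨H, hH, hHdeg⟩ := hc'.exists_graph
  refine ⟨H, fun v => ?_, hH⟩
  have h1 := h0 v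
  have h2 := h0' v
  rw [← hG v, Nat.cast_inj]
  have h3 := hHdeg v
  have h4 : G.degree v = H.degree v := by omega
  convert h4.symm
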